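/- Let $b\ge 0$ and $c>0$ be real numbers and let $p\ge 1$ be an integer, and consider the equation $$u_t-u_{txx}+(b+c)u^pu_x=bu^{p-1}u_xu_{xx}+cu^pu_{xxx} \qquad (\ast)$$ for functions $u(t,x)$ that are $1$-periodic in $x$, i.e. for $x$ in the circle $\mathbb S=\mathbb R/\mathbb Z$. Suppose that $p=1$ and $b\in[0,3c]$, or that $b=pc$. Let $s>3/2$, $0<T\le\infty$, and let $u\in C^0([0,T),H^s(\mathbb S))$ be a real-valued solution of $(\ast)$ (in the sense of distributions on $(0,T)\times\mathbb S$) that is non-negative on $[0,T)\times\mathbb S$ or non-positive on $[0,T)\times\mathbb S$. If there are $t_0<t_1$ and $x_0<x_1$ with $(t_0,t_1)\subseteq[0,T)$ such that $u(t,x)=0$ for all $t\in(t_0,t_1)$ and $x\in(x_0,x_1)$, then $u(t,x)=0$ for all $(t,x)\in[0,T)\times\mathbb S$. Here $u(t,\cdot)$ denotes the continuous ($C^1$) representative, and the nonlinear terms are understood as the distributions $$u^{p-1}u_xu_{xx}=\tfrac12\big(u^{p-1}u_x^2\big)_x-\tfrac{p-1}{2}u^{p-2}u_x^3,\qquad u^pu_{xxx}=(u^pu_x)_{xx}-\tfrac{3p}{2}\big(u^{p-1}u_x^2\big)_x+\tfrac{p(p-1)}{2}u^{p-2}u_x^3$$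 (for $p=1$ the terms containing $u^{p-2}$ are absent). -/

import Mathlib

open Set Filter Topology MeasureTheory
open scoped ContDiff

namespace PeriodicShallowWater

noncomputable section

/-- The circle `𝕊 = ℝ / ℤ`: functions on `𝕊` are `1`-periodic functions on `ℝ`. This is the
`n`-th Fourier coefficient `∫₀¹ f(x) e^{-2π i n x} dx` of such a function. -/
def circleFourierCoeff (f : ℝ → ℝ) (n : ℤ) : ℂ :=
  fourierCoeffOn (zero_lt_one : (0 : ℝ) < 1) (fun x => (f x : ℂ)) n

/-- The `n`-th summand `(1 + (2πn)²)^s |f̂(n)|²` of the squared `H^s(𝕊)` norm. -/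
def sobolevTerm (s : ℝ) (f : ℝ → ℝ) (n : ℤ) : ℝ :=
  (1 + (2 * Real.pi * (n : ℝ)) ^ 2) ^ s * ‖circleFourierCoeff f n‖ ^ 2

/-- The (real) Sobolev space `H^s(𝕊)`, for `s ≥ 0`: the `1`-periodic functions, square integrable
over a period, for which `∑ₙ (1 + (2πn)²)^s |f̂(n)|² < ∞`. -/
structure MemSobolev (s : ℝ) (f : ℝ → ℝ) : Prop where
  periodic : Function.Periodic f 1
  memLp : MemLp f 2 (volume.restrict (Ioc (0 : ℝ) 1))
  summable : Summable (sobolevTerm s f)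

/-- The norm of `H^s(𝕊)`. -/
def sobolevNorm (s : ℝ) (f : ℝ → ℝ) : ℝ :=
  Real.sqrt (∑' n : ℤ, sobolevTerm s f n)

/-- The time interval `[0, T)`, where `0 < T ≤ ∞`. -/
def timeInterval (T : EReal) : Set ℝ :=
  {t : ℝ | 0 ≤ t ∧ (t : EReal) < T}

/-- `u ∈ C⁰([0, T), H^s(𝕊))`. -/
structure ContinuousInSobolev (s : ℝ) (T : EReal) (u : ℝ → ℝ → ℝ) : Prop where
  mem : ∀ t ∈ timeInterval T, MemSobolev s (u t)
  tendsto : ∀ t₀ ∈ timeInterval T,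
    Tendsto (fun t => sobolevNorm s (u t - u t₀)) (𝓝[timeInterval T] t₀) (𝓝 0)

/-- Test functions on `(0, T) × 𝕊`: smooth functions of `(t, x)`, `1`-periodic in `x`, whose
support is contained in `[t₁, t₂] × 𝕊` for some `0 < t₁` and `t₂ < T`. -/
structure IsTestFunction (T : EReal) (φ : ℝ → ℝ → ℝ) : Prop where
  smooth : ContDiff ℝ ∞ (fun z : ℝ × ℝ => φ z.1 z.2)
  periodic : ∀ t, Function.Periodic (φ t) 1
  support : ∃ t₁ t₂ : ℝ, 0 < t₁ ∧ (t₂ : EReal) < T ∧ ∀ t, t ∉ Icc t₁ t₂ → ∀ x, φ t x = 0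

/-- The integral of `h` over `[0, T) × 𝕊`. -/
def spaceTimeIntegral (T : EReal) (h : ℝ → ℝ → ℝ) : ℝ :=
  ∫ t in timeInterval T, ∫ x in (0 : ℝ)..1, h t x

/-- The equation
`u_t - u_txx + (b + c) u^p u_x = b u^(p-1) u_x u_xx + c u^p u_xxx`
in the sense of distributions on `(0, T) × 𝕊`, for `u` that is `C¹` in `x`. In the weak form
derivatives of `u` of order at least two, and those in `t`, are moved to the test function `φ`:
* `u_t - u_txx` becomes `- u (φ_t - φ_txx)`;
* `u^(p-1) u_x u_xx = ½ (u^(p-1) u_x²)_x - ½ (p-1) u^(p-2) u_x³` becomes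
  `- ½ (u^(p-1) u_x² φ_x + (p-1) u^(p-2) u_x³ φ)`;
* `u^p u_xxx = (u^p u_x)_xx - (3p/2) (u^(p-1) u_x²)_x + ½ p (p-1) u^(p-2) u_x³` becomes
  `u^p u_x φ_xx + (3p/2) u^(p-1) u_x² φ_x + ½ p (p-1) u^(p-2) u_x³ φ`.

For `p = 1` the terms with the exponent `p - 2` have the coefficient `0`. -/
def SolvesEquation (b c : ℝ) (p : ℕ) (T : EReal) (u : ℝ → ℝ → ℝ) : Prop :=
  ∀ φ : ℝ → ℝ → ℝ, IsTestFunction T φ →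
    spaceTimeIntegral T (fun t x =>
      - (u t x * (deriv (fun τ => φ τ x) t - deriv (fun τ => iteratedDeriv 2 (φ τ) x) t))
      + (b + c) * u t x ^ p * deriv (u t) x * φ t x)
    =
    spaceTimeIntegral T (fun t x =>
      b * (- (1 / 2) * (u t x ^ (p - 1) * deriv (u t) x ^ 2 * deriv (φ t) x
        + ((p : ℝ) - 1) * u t x ^ (p - 2) * deriv (u t) x ^ 3 * φ t x))
      + c * (u t x ^ p * deriv (u t) x * iteratedDeriv 2 (φ t) x
        + 3 * (p : ℝ) / 2 * (u t x ^ (p - 1) * deriv (u t) x ^ 2 * deriv (φ t) x)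
        + (p : ℝ) * ((p : ℝ) - 1) / 2 * (u t x ^ (p - 2) * deriv (u t) x ^ 3 * φ t x)))

/-- A solution `u ∈ C⁰([0, T), H^s(𝕊))` of the equation; used for `s > 3/2`. As usual, `u(t, ·)`
stands for the continuous representative of its class, which exists, and is `C¹`, for
`s > 3/2`. -/
structure IsSobolevSolution (b c : ℝ) (p : ℕ) (s : ℝ) (T : EReal) (u : ℝ → ℝ → ℝ) : Prop where
  continuous_slice : ∀ t ∈ timeInterval T, Continuous (u t)
  continuousInSobolev : ContinuousInSobolev s T u
  solves : SolvesEquation b c p T u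

end

end PeriodicShallowWater

namespace PeriodicShallowWater

/-! Formally the equation is `u_t + c u^p u_x = -∂ₓ (1 - ∂ₓ²)⁻¹ F` with the flux `F = b/(p+1)
u^(p+1) + (3pc-b)/2 u^(p-1) u_x²`. The assumption on `b` and `p` does two things: it removes the
cubic term, whose coefficient is a multiple of `(p-1)(pc-b)`, and it gives `3pc - b ≥ 0`, so that
`F` has a fixed sign when `u` has one.

The inverse of `1 - ∂ₓ²` is never formed. Testing with `θ(t) ψ(x)` gives (`weak_form_mul`) `∫ θ' ∫ u
(ψ - ψ'') + ∫ θ ∫ (F ψ' + c u^p u_x (ψ'' - ψ)) = 0`. On the circle no `ψ` satisfies both `ψ'' = ψ`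
and `ψ' > 0` everywhere, but such a `ψ` exists away from the interval on which `u` vanishes
(`exists_periodic_profile`). For times in the given rectangle all that remains is `∫ θ ∫ F ψ' = 0`.
Since `F` has a sign and vanishes wherever `u` does, `F = 0` on each of these time slices, and hence
`u = 0` there (`slice_eq_zero_of_rectangle`).

The choice `ψ = 1` shows that `∫ u dx` is conserved. It is zero on the slices just found, hence at
all positive times, and the sign of `u` gives `u = 0` (`eq_zero_of_slices`). Time zero follows by
continuity. -/

/-! ### Fourier series and the embedding of `H^s(𝕊)` into `C¹(𝕊)` -/

theorem circleFourierCoeff_eq_integral (f : ℝ → ℝ) (n : ℤ) :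
    circleFourierCoeff f n =
      ∫ x in (0 : ℝ)..1, Complex.exp (2 * Real.pi * Complex.I * (-n) * x) * (f x : ℂ) := by
  unfold circleFourierCoeff
  rw [fourierCoeffOn_eq_integral]
  simp only [fourier_coe_apply, sub_zero, smul_eq_mul]
  simp

theorem circleFourierCoeff_eq_fourierCoeff {f : ℝ → ℝ} (hf : Function.Periodic f 1) (n : ℤ) :
    circleFourierCoeff f n =
      fourierCoeff (T := (1 : ℝ)) (fun x => ((hf.lift x : ℝ) : ℂ)) n := by
  rw [circleFourierCoeff_eq_integral, fourierCoeff_eq_intervalIntegral _ _ 0]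
  simp only [fourier_coe_apply, zero_add, smul_eq_mul]
  simp

theorem circleFourierCoeff_sub {f g : ℝ → ℝ} (hf : Continuous f) (hg : Continuous g) (n : ℤ) :
    circleFourierCoeff (f - g) n = circleFourierCoeff f n - circleFourierCoeff g n := by
  simp only [circleFourierCoeff_eq_integral]
  rw [← intervalIntegral.integral_sub]
  · simp [mul_sub]
  · exact Continuous.intervalIntegrable (by fun_prop) _ _
  · exact Continuous.intervalIntegrable (by fun_prop) _ _

theorem one_le_sobolevWeight (n : ℤ) : 1 ≤ 1 + (2 * Real.pi * (n : ℝ)) ^ 2 := by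
  nlinarith [sq_nonneg (2 * Real.pi * (n : ℝ))]

theorem sobolevTerm_nonneg (s : ℝ) (f : ℝ → ℝ) (n : ℤ) : 0 ≤ sobolevTerm s f n := by
  have := one_le_sobolevWeight n
  unfold sobolevTerm
  positivity

theorem summable_sobolevTerm_sub {s : ℝ} {f g : ℝ → ℝ} (hf : Continuous f) (hg : Continuous g)
    (hfs : Summable (sobolevTerm s f)) (hgs : Summable (sobolevTerm s g)) :
    Summable (sobolevTerm s (f - g)) := by
  refine Summable.of_nonneg_of_le (sobolevTerm_nonneg s _) (fun n => ?_)
    ((hfs.mul_left 2).add (hgs.mul_left 2))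
  have h1 := one_le_sobolevWeight n
  have h2 : ‖circleFourierCoeff (f - g) n‖ ^ 2 ≤
      2 * ‖circleFourierCoeff f n‖ ^ 2 + 2 * ‖circleFourierCoeff g n‖ ^ 2 := by
    rw [circleFourierCoeff_sub hf hg]
    have := norm_sub_le (circleFourierCoeff f n) (circleFourierCoeff g n)
    have h0 := norm_nonneg (circleFourierCoeff f n - circleFourierCoeff g n)
    nlinarith [sq_nonneg (‖circleFourierCoeff f n‖ - ‖circleFourierCoeff g n‖)]
  have h3 : 0 ≤ (1 + (2 * Real.pi * (n : ℝ)) ^ 2) ^ s := by positivity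
  unfold sobolevTerm
  nlinarith [mul_le_mul_of_nonneg_left h2 h3]

theorem summable_sobolevWeight_rpow {s : ℝ} (hs : 3 / 2 < s) :
    Summable (fun n : ℤ => (1 + (2 * Real.pi * (n : ℝ)) ^ 2) ^ (1 - s)) := by
  have h := Real.summable_abs_int_rpow (b := 2 * (s - 1)) (by linarith)
  -- The comparison fails at `n = 0`, where the left side is `1` and the negative power of `0` is
  -- `0` by convention.
  refine Summable.of_norm_bounded_eventually h ?_
  have : ∀ᶠ n : ℤ in cofinite, n ≠ 0 := eventually_cofinite_ne 0
  filter_upwards [this] with n hn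
  have h1 := one_le_sobolevWeight n
  have hn' : 0 < |(n : ℝ)| := abs_pos.mpr (by exact_mod_cast hn)
  rw [Real.norm_of_nonneg (by positivity)]
  have h2 : |(n : ℝ)| ^ (-(2 * (s - 1))) = (|(n : ℝ)| ^ 2) ^ (1 - s) := by
    rw [← Real.rpow_natCast, ← Real.rpow_mul hn'.le]
    congr 1; push_cast; ring
  rw [h2]
  refine Real.rpow_le_rpow_of_nonpos (by positivity) ?_ (by linarith)
  rw [sq_abs, mul_pow]
  have h3 : 1 ≤ (2 * Real.pi) ^ 2 := by nlinarith [Real.pi_gt_three]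
  nlinarith [sq_nonneg (n : ℝ)]

/-- The constant of the embedding of `H^s(𝕊)` into `C¹(𝕊)`. -/
noncomputable def embeddingConstant (s : ℝ) : ℝ :=
  Real.sqrt (∑' n : ℤ, (1 + (2 * Real.pi * (n : ℝ)) ^ 2) ^ (1 - s))

/-- Cauchy–Schwarz: with `w = 1 + (2πn)²`, write `√w |f̂|` as `w^((1-s)/2)` times `w^(s/2) |f̂|`.
The first factor is square summable because `2(s-1) > 1`. The sum dominates the Fourier series of
both `f` and `f'`. -/
theorem summable_weighted_coeff {s : ℝ} (hs : 3 / 2 < s) {f : ℝ → ℝ}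
    (hf : Summable (sobolevTerm s f)) :
    Summable (fun n : ℤ =>
      Real.sqrt (1 + (2 * Real.pi * (n : ℝ)) ^ 2) * ‖circleFourierCoeff f n‖) ∧
    ∑' n : ℤ, Real.sqrt (1 + (2 * Real.pi * (n : ℝ)) ^ 2) * ‖circleFourierCoeff f n‖ ≤
      embeddingConstant s * sobolevNorm s f := by
  have h := Real.summable_and_inner_le_Lp_mul_Lq_tsum_of_nonneg Real.HolderConjugate.two_two
    (f := fun n : ℤ => (1 + (2 * Real.pi * (n : ℝ)) ^ 2) ^ ((1 - s) / 2))
    (g := fun n : ℤ => (1 + (2 * Real.pi * (n : ℝ)) ^ 2) ^ (s / 2) * ‖circleFourierCoeff f n‖)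
    (fun n => by positivity) (fun n => by positivity)
  have e1 : ∀ n : ℤ, ((1 + (2 * Real.pi * (n : ℝ)) ^ 2) ^ ((1 - s) / 2)) ^ (2 : ℝ) =
      (1 + (2 * Real.pi * (n : ℝ)) ^ 2) ^ (1 - s) := fun n => by
    rw [← Real.rpow_mul (by positivity)]; congr 1; ring
  have e2 : ∀ n : ℤ, ((1 + (2 * Real.pi * (n : ℝ)) ^ 2) ^ (s / 2) *
      ‖circleFourierCoeff f n‖) ^ (2 : ℝ) = sobolevTerm s f n := fun n => by
    rw [Real.mul_rpow (by positivity) (by positivity), ← Real.rpow_mul (by positivity),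
      sobolevTerm, Real.rpow_two]
    congr 2; ring
  have e3 : ∀ n : ℤ, (1 + (2 * Real.pi * (n : ℝ)) ^ 2) ^ ((1 - s) / 2) *
      ((1 + (2 * Real.pi * (n : ℝ)) ^ 2) ^ (s / 2) * ‖circleFourierCoeff f n‖) =
      Real.sqrt (1 + (2 * Real.pi * (n : ℝ)) ^ 2) * ‖circleFourierCoeff f n‖ := fun n => by
    rw [← mul_assoc, ← Real.rpow_add (by positivity), Real.sqrt_eq_rpow]
    congr 2; ring
  simp only [e1, e2, e3, ← Real.sqrt_eq_rpow] at h
  exact h (summable_sobolevWeight_rpow hs) hf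

theorem norm_coeff_le (f : ℝ → ℝ) (n : ℤ) : ‖circleFourierCoeff f n‖ ≤
    Real.sqrt (1 + (2 * Real.pi * (n : ℝ)) ^ 2) * ‖circleFourierCoeff f n‖ :=
  le_mul_of_one_le_left (norm_nonneg _) (Real.one_le_sqrt.mpr (one_le_sobolevWeight n))

theorem hasSum_circleFourierCoeff {f : ℝ → ℝ} (hf : Continuous f) (hp : Function.Periodic f 1)
    (h : Summable fun n => ‖circleFourierCoeff f n‖) (x : ℝ) :
    HasSum (fun n : ℤ => circleFourierCoeff f n *
      Complex.exp (2 * Real.pi * Complex.I * n * x)) (f x) := by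
  have hc : Continuous (hp.lift) := continuous_coinduced_dom.mpr hf
  let F : C(AddCircle (1 : ℝ), ℂ) := ⟨fun x => ((hp.lift x : ℝ) : ℂ), by fun_prop⟩
  have e : fourierCoeff F = circleFourierCoeff f := by
    ext n; exact (circleFourierCoeff_eq_fourierCoeff hp n).symm
  have := has_pointwise_sum_fourier_series_of_summable (f := F) (by rw [e]; exact h.of_norm) x
  rw [e] at this
  simpa [fourier_coe_apply, F, mul_comm] using this

/-- The termwise derivative of the Fourier series. -/
noncomputable def fourierDeriv (f : ℝ → ℝ) (x : ℝ) : ℝ :=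
  (∑' n : ℤ, circleFourierCoeff f n *
    (2 * Real.pi * Complex.I * n * Complex.exp (2 * Real.pi * Complex.I * n * x))).re

theorem norm_exp_fourier (n : ℤ) (x : ℝ) :
    ‖Complex.exp (2 * Real.pi * Complex.I * n * x)‖ = 1 := by
  have : (2 * Real.pi * Complex.I * n * x : ℂ) = ((2 * Real.pi * n * x : ℝ) : ℂ) * Complex.I := by
    push_cast; ring
  rw [this, Complex.norm_exp_ofReal_mul_I]

theorem norm_deriv_term_le (f : ℝ → ℝ) (n : ℤ) (x : ℝ) :
    ‖circleFourierCoeff f n *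
      (2 * Real.pi * Complex.I * n * Complex.exp (2 * Real.pi * Complex.I * n * x))‖ ≤
    Real.sqrt (1 + (2 * Real.pi * (n : ℝ)) ^ 2) * ‖circleFourierCoeff f n‖ := by
  rw [norm_mul, norm_mul, norm_exp_fourier, mul_one, mul_comm]
  refine mul_le_mul_of_nonneg_right (Real.le_sqrt_of_sq_le ?_) (norm_nonneg _)
  have : ‖(2 * Real.pi * Complex.I * n : ℂ)‖ ^ 2 = (2 * Real.pi * (n : ℝ)) ^ 2 := by
    rw [← sq_abs (2 * Real.pi * (n : ℝ))]
    simp [abs_mul]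
  rw [this]; linarith

section Embedding

variable {s : ℝ} {f : ℝ → ℝ}

theorem hasDerivAt_of_sobolev (hs : 3 / 2 < s) (hf : Continuous f) (hp : Function.Periodic f 1)
    (h : Summable (sobolevTerm s f)) (x : ℝ) : HasDerivAt f (fourierDeriv f x) x := by
  have hS := (summable_weighted_coeff hs h).1
  have hN := Summable.of_nonneg_of_le (fun n => norm_nonneg _) (norm_coeff_le f) hS
  have hd : HasDerivAt (fun x : ℝ => ∑' n : ℤ, circleFourierCoeff f n *
      Complex.exp (2 * Real.pi * Complex.I * n * x)) (∑' n : ℤ, circleFourierCoeff f n *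
    (2 * Real.pi * Complex.I * n * Complex.exp (2 * Real.pi * Complex.I * n * x))) x := by
    refine hasDerivAt_tsum hS (fun n y => ?_) (fun n y => norm_deriv_term_le f n y)
      (hasSum_circleFourierCoeff hf hp hN 0).summable x
    have h1 : HasDerivAt (fun y : ℝ => (2 * Real.pi * Complex.I * n * y : ℂ))
        (2 * Real.pi * Complex.I * n) y := by
      simpa using (Complex.ofRealCLM.hasDerivAt (x := y)).const_mul
        (2 * Real.pi * Complex.I * n : ℂ)
    simpa [mul_comm] using (h1.cexp).const_mul (circleFourierCoeff f n)
  have e : (fun x : ℝ => ∑' n : ℤ, circleFourierCoeff f n *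
      Complex.exp (2 * Real.pi * Complex.I * n * x)) = fun x => (f x : ℂ) := by
    ext y; exact (hasSum_circleFourierCoeff hf hp hN y).tsum_eq
  rw [e] at hd
  exact Complex.reCLM.hasFDerivAt.comp_hasDerivAt x hd

theorem continuous_fourierDeriv (hs : 3 / 2 < s) (h : Summable (sobolevTerm s f)) :
    Continuous (fourierDeriv f) :=
  Complex.continuous_re.comp (continuous_tsum (fun n => by fun_prop)
    (summable_weighted_coeff hs h).1 (fun n x => norm_deriv_term_le f n x))

theorem continuous_deriv_of_sobolev (hs : 3 / 2 < s) (hf : Continuous f)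
    (hp : Function.Periodic f 1) (h : Summable (sobolevTerm s f)) : Continuous (deriv f) := by
  have : deriv f = fourierDeriv f := by
    ext x; exact (hasDerivAt_of_sobolev hs hf hp h x).deriv
  rw [this]; exact continuous_fourierDeriv hs h

theorem abs_deriv_le_sobolevNorm (hs : 3 / 2 < s) (hf : Continuous f)
    (hp : Function.Periodic f 1) (h : Summable (sobolevTerm s f)) (x : ℝ) :
    |deriv f x| ≤ embeddingConstant s * sobolevNorm s f := by
  obtain ⟨hS, hle⟩ := summable_weighted_coeff hs h
  rw [(hasDerivAt_of_sobolev hs hf hp h x).deriv]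
  exact (Complex.abs_re_le_norm _).trans
    ((tsum_of_norm_bounded hS.hasSum (fun n => norm_deriv_term_le f n x)).trans hle)

theorem abs_le_sobolevNorm (hs : 3 / 2 < s) (hf : Continuous f)
    (hp : Function.Periodic f 1) (h : Summable (sobolevTerm s f)) (x : ℝ) :
    |f x| ≤ embeddingConstant s * sobolevNorm s f := by
  obtain ⟨hS, hle⟩ := summable_weighted_coeff hs h
  have hN := Summable.of_nonneg_of_le (fun n => norm_nonneg _) (norm_coeff_le f) hS
  rw [← Real.norm_eq_abs, ← Complex.norm_real, ← (hasSum_circleFourierCoeff hf hp hN x).tsum_eq]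
  refine (tsum_of_norm_bounded hS.hasSum (fun n => ?_)).trans hle
  rw [norm_mul, norm_exp_fourier, mul_one]
  exact norm_coeff_le f n

end Embedding

/-! ### Joint continuity of `u` and `u_x` in `(t, x)` -/

theorem continuous_uncurry_of_abs_sub_le {X : Type*} [TopologicalSpace X] {f : X → ℝ → ℝ}
    (hf : ∀ t, Continuous (f t)) {N : X → X → ℝ} (hN : ∀ t t₀ x, |f t x - f t₀ x| ≤ N t t₀)
    (h0 : ∀ t₀, Tendsto (fun t => N t t₀) (𝓝 t₀) (𝓝 0)) :
    Continuous (fun z : X × ℝ => f z.1 z.2) := by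
  rw [continuous_iff_continuousAt]
  rintro ⟨t₀, x₀⟩
  unfold ContinuousAt
  rw [tendsto_iff_dist_tendsto_zero]
  have h1 : Tendsto (fun z : X × ℝ => N z.1 t₀ + dist (f t₀ z.2) (f t₀ x₀)) (𝓝 (t₀, x₀))
      (𝓝 (0 + 0)) := by
    refine ((h0 t₀).comp (continuous_fst.tendsto' _ _ rfl)).add ?_
    rw [← tendsto_iff_dist_tendsto_zero]
    exact ((hf t₀).comp continuous_snd).tendsto' _ _ rfl
  rw [add_zero] at h1
  refine squeeze_zero (fun _ => dist_nonneg) (fun z => ?_) h1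
  refine (dist_triangle _ (f t₀ z.2) _).trans (add_le_add_left ?_ _)
  rw [Real.dist_eq]; exact hN _ _ _

section Regularity

variable {b c s : ℝ} {p : ℕ} {T : EReal} {u : ℝ → ℝ → ℝ}

theorem IsSobolevSolution.differentiable (hu : IsSobolevSolution b c p s T u) (hs : 3 / 2 < s)
    {t : ℝ} (ht : t ∈ timeInterval T) : Differentiable ℝ (u t) := fun x =>
  (hasDerivAt_of_sobolev hs (hu.continuous_slice t ht) (hu.continuousInSobolev.mem t ht).periodic
    (hu.continuousInSobolev.mem t ht).summable x).differentiableAt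

theorem IsSobolevSolution.continuous_deriv (hu : IsSobolevSolution b c p s T u) (hs : 3 / 2 < s)
    {t : ℝ} (ht : t ∈ timeInterval T) : Continuous (deriv (u t)) :=
  continuous_deriv_of_sobolev hs (hu.continuous_slice t ht)
    (hu.continuousInSobolev.mem t ht).periodic (hu.continuousInSobolev.mem t ht).summable

theorem IsSobolevSolution.tendsto_norm (hu : IsSobolevSolution b c p s T u)
    (t₀ : timeInterval T) :
    Tendsto (fun t : timeInterval T => embeddingConstant s * sobolevNorm s (u t - u t₀)) (𝓝 t₀)
      (𝓝 0) := by
  have h := hu.continuousInSobolev.tendsto t₀ t₀.2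
  rw [nhdsWithin_eq_map_subtype_coe t₀.2, tendsto_map'_iff] at h
  simpa using h.const_mul (embeddingConstant s)

theorem IsSobolevSolution.continuous_uncurry (hu : IsSobolevSolution b c p s T u)
    (hs : 3 / 2 < s) : Continuous (fun z : timeInterval T × ℝ => u z.1 z.2) := by
  refine continuous_uncurry_of_abs_sub_le (f := fun t : timeInterval T => u t)
    (fun t => hu.continuous_slice t t.2) (fun t t₀ x => ?_) hu.tendsto_norm
  have h1 := hu.continuousInSobolev.mem t t.2
  have h2 := hu.continuousInSobolev.mem t₀ t₀.2
  have c1 := hu.continuous_slice t t.2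
  have c2 := hu.continuous_slice t₀ t₀.2
  exact abs_le_sobolevNorm hs (c1.sub c2) (h1.periodic.sub h2.periodic)
    (summable_sobolevTerm_sub c1 c2 h1.summable h2.summable) x

theorem IsSobolevSolution.continuous_uncurry_deriv (hu : IsSobolevSolution b c p s T u)
    (hs : 3 / 2 < s) : Continuous (fun z : timeInterval T × ℝ => deriv (u z.1) z.2) := by
  refine continuous_uncurry_of_abs_sub_le (f := fun t : timeInterval T => deriv (u t))
    (fun t => hu.continuous_deriv hs t.2) (fun t t₀ x => ?_) hu.tendsto_norm
  have h1 := hu.continuousInSobolev.mem t t.2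
  have h2 := hu.continuousInSobolev.mem t₀ t₀.2
  have c1 := hu.continuous_slice t t.2
  have c2 := hu.continuous_slice t₀ t₀.2
  have := abs_deriv_le_sobolevNorm hs (c1.sub c2) (h1.periodic.sub h2.periodic)
    (summable_sobolevTerm_sub c1 c2 h1.summable h2.summable) x
  rwa [deriv_sub (hu.differentiable hs t.2 x) (hu.differentiable hs t₀.2 x)] at this

end Regularity

/-! ### Product test functions and space-time integrals -/

theorem mem_timeInterval_of_le {T : EReal} {t d : ℝ} (hd : d ∈ timeInterval T) (h0 : 0 ≤ t)
    (htd : t ≤ d) : t ∈ timeInterval T :=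
  ⟨h0, lt_of_le_of_lt (by exact_mod_cast htd) hd.2⟩

theorem isTestFunction_mul {T : EReal} {θ ψ : ℝ → ℝ} {a d : ℝ} (hθ : ContDiff ℝ ∞ θ)
    (hψ : ContDiff ℝ ∞ ψ) (hper : Function.Periodic ψ 1) (ha : 0 < a) (hd : d ∈ timeInterval T)
    (h0 : ∀ t, t ∉ Icc a d → θ t = 0) : IsTestFunction T (fun t x => θ t * ψ x) where
  smooth := (hθ.comp contDiff_fst).mul (hψ.comp contDiff_snd)
  periodic t x := by simp [hper x]
  support := ⟨a, d, ha, hd.2, fun t ht x => by simp [h0 t ht]⟩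

theorem deriv_eq_zero_of_notMem_Icc {θ : ℝ → ℝ} {a d : ℝ} (h0 : ∀ t, t ∉ Icc a d → θ t = 0)
    {t : ℝ} (ht : t ∉ Icc a d) : deriv θ t = 0 := by
  have : θ =ᶠ[𝓝 t] fun _ => (0 : ℝ) := by
    filter_upwards [isClosed_Icc.isOpen_compl.mem_nhds ht] with y hy using h0 y hy
  rw [this.deriv_eq, deriv_const]

theorem continuousOn_parametric_integral {T : EReal} {G : ℝ → ℝ → ℝ}
    (hG : Continuous (fun z : timeInterval T × ℝ => G z.1 z.2)) :
    ContinuousOn (fun t => ∫ x in (0 : ℝ)..1, G t x) (timeInterval T) := by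
  rw [continuousOn_iff_continuous_domRestrict]
  exact intervalIntegral.continuous_parametric_intervalIntegral_of_continuous'
    (f := fun (t : timeInterval T) x => G t x) hG 0 1

theorem spaceTimeIntegral_eq {T : EReal} {h : ℝ → ℝ → ℝ} {a d : ℝ} (ha : 0 < a) (had : a ≤ d)
    (hd : d ∈ timeInterval T) (h0 : ∀ t, t ∉ Icc a d → ∀ x, h t x = 0) :
    spaceTimeIntegral T h = ∫ t in a..d, ∫ x in (0 : ℝ)..1, h t x := by
  rw [intervalIntegral.integral_of_le had, ← integral_Icc_eq_integral_Ioc, spaceTimeIntegral]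
  refine (setIntegral_eq_of_subset_of_forall_sdiff_eq_zero ?_ ?_ ?_)
  · have : timeInterval T = Ici 0 ∩ (fun t : ℝ => (t : EReal)) ⁻¹' (Iio T) := rfl
    rw [this]
    exact measurableSet_Ici.inter (measurable_coe_real_ereal measurableSet_Iio)
  · exact fun t ht => mem_timeInterval_of_le hd (ha.le.trans ht.1) ht.2
  · intro t ht
    simp [h0 t ht.2]

theorem eq_zero_of_integral_eq_zero {f : ℝ → ℝ} {a d : ℝ} (had : a < d)
    (hf : ContinuousOn f (Icc a d)) (h0 : ∀ x ∈ Icc a d, 0 ≤ f x)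
    (hint : ∫ x in a..d, f x = 0) : ∀ x ∈ Icc a d, f x = 0 := by
  intro x hx
  by_contra hne
  exact (intervalIntegral.integral_pos had hf (fun y hy => h0 y (Ioc_subset_Icc_self hy))
    ⟨x, hx, lt_of_le_of_ne (h0 x hx) (Ne.symm hne)⟩).ne' hint

/-! ### The weak form with the flux -/

section WeakForm

variable {b c s : ℝ} {p : ℕ} {T : EReal} {u : ℝ → ℝ → ℝ}

/-- The flux `F = b/(p+1) u^(p+1) + (3pc-b)/2 u^(p-1) u_x²` of the nonlocal form
`u_t + c u^p u_x = -∂ₓ (1 - ∂ₓ²)⁻¹ F` of the equation. -/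
noncomputable def flux (b c : ℝ) (p : ℕ) (f : ℝ → ℝ) (x : ℝ) : ℝ :=
  f x ^ (p - 1) * (b / (p + 1) * f x ^ 2 + (3 * p * c - b) / 2 * deriv f x ^ 2)

theorem integral_pow_mul_deriv_add {f ψ : ℝ → ℝ} (hf : Differentiable ℝ f)
    (hf' : Continuous (deriv f)) (hfp : Function.Periodic f 1) (hψ : ContDiff ℝ ∞ ψ)
    (hψp : Function.Periodic ψ 1) (p : ℕ) :
    ∫ x in (0 : ℝ)..1, ((p + 1) * f x ^ p * deriv f x * ψ x + f x ^ (p + 1) * deriv ψ x) = 0 := by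
  have hψ' : Continuous (deriv ψ) := hψ.continuous_deriv (by simp)
  have hfc := hf.continuous
  have hψc := hψ.continuous
  rw [intervalIntegral.integral_eq_sub_of_hasDerivAt (f := fun x => f x ^ (p + 1) * ψ x)]
  · have h1 : f 1 = f 0 := by simpa using hfp 0
    have h2 : ψ 1 = ψ 0 := by simpa using hψp 0
    simp [h1, h2]
  · intro x _
    have h1 := ((hf x).hasDerivAt.fun_pow (p + 1)).fun_mul
      ((hψ.differentiable (by simp)) x).hasDerivAt
    simpa using h1
  · exact Continuous.intervalIntegrable (by fun_prop) _ _

/-- This is the nonlocal form paired with `(1 - ∂ₓ²)(θψ)`, obtained from the distributional equation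
by one integration by parts in `x`; `hbc` cancels the cubic term. -/
theorem IsSobolevSolution.weak_form_mul (hu : IsSobolevSolution b c p s T u) (hs : 3 / 2 < s)
    (hp : 0 < p) (hbc : ((p : ℝ) - 1) * (p * c - b) = 0) {θ ψ : ℝ → ℝ} {a d : ℝ}
    (hθ : ContDiff ℝ ∞ θ) (hψ : ContDiff ℝ ∞ ψ) (hper : Function.Periodic ψ 1) (ha : 0 < a)
    (had : a ≤ d) (hd : d ∈ timeInterval T) (h0 : ∀ t, t ∉ Icc a d → θ t = 0) :
    ∫ t in a..d, (deriv θ t * (∫ x in (0 : ℝ)..1, u t x * (ψ x - iteratedDeriv 2 ψ x)) +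
      θ t * ∫ x in (0 : ℝ)..1, (flux b c p (u t) x * deriv ψ x +
        c * u t x ^ p * deriv (u t) x * (iteratedDeriv 2 ψ x - ψ x))) = 0 := by
  obtain ⟨q, rfl⟩ : ∃ q, p = q + 1 := ⟨p - 1, by omega⟩
  have h := hu.solves _ (isTestFunction_mul hθ hψ hper ha hd h0)
  -- Opaque names for `u` and `u_x` as jointly continuous functions let `fun_prop` handle the
  -- integrands.
  obtain ⟨U, hU, hUe⟩ : ∃ U : timeInterval T × ℝ → ℝ, Continuous U ∧ ∀ z, u z.1 z.2 = U z :=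
    ⟨_, hu.continuous_uncurry hs, fun _ => rfl⟩
  obtain ⟨D, hD, hDe⟩ : ∃ D : timeInterval T × ℝ → ℝ, Continuous D ∧
      ∀ z, deriv (u z.1) z.2 = D z := ⟨_, hu.continuous_uncurry_deriv hs, fun _ => rfl⟩
  have e1 : ∀ t x, deriv (fun τ => θ τ * ψ x) t = deriv θ t * ψ x := fun t x =>
    deriv_mul_const ((hθ.differentiable (by simp)) t) _
  have e2 : ∀ t x, deriv (fun y => θ t * ψ y) x = θ t * deriv ψ x := fun t x =>
    deriv_const_mul _ ((hψ.differentiable (by simp)) x)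
  have e3 : ∀ t x, iteratedDeriv 2 (fun y => θ t * ψ y) x = θ t * iteratedDeriv 2 ψ x :=
    fun t x => by
      have : deriv (fun y => θ t * ψ y) = fun y => θ t * deriv ψ y := funext (e2 t)
      rw [iteratedDeriv_succ, iteratedDeriv_one, iteratedDeriv_succ, iteratedDeriv_one, this,
        deriv_const_mul_field]
  have e4 : ∀ t x, deriv (fun τ => θ τ * iteratedDeriv 2 ψ x) t =
      deriv θ t * iteratedDeriv 2 ψ x := fun t x =>
    deriv_mul_const ((hθ.differentiable (by simp)) t) _
  simp only [e1, e2, e3, e4] at h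
  have hθ0 := fun t ht => deriv_eq_zero_of_notMem_Icc h0 (t := t) ht
  rw [spaceTimeIntegral_eq ha had hd (fun t ht x => by simp [h0 t ht, hθ0 t ht]),
    spaceTimeIntegral_eq ha had hd (fun t ht x => by simp [h0 t ht]), ← sub_eq_zero] at h
  have hθc := hθ.continuous
  have hθ' : Continuous (deriv θ) := hθ.continuous_deriv (by simp)
  have hψc := hψ.continuous
  have hψ' : Continuous (deriv ψ) := hψ.continuous_deriv (by simp)
  have hψ'' : Continuous (iteratedDeriv 2 ψ) := hψ.continuous_iteratedDeriv 2 (by norm_cast)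
  have hsub : Icc a d ⊆ timeInterval T :=
    fun t ht => mem_timeInterval_of_le hd (ha.le.trans ht.1) ht.2
  have hint : ∀ {G : ℝ → ℝ → ℝ}, Continuous (fun z : timeInterval T × ℝ => G z.1 z.2) →
      IntervalIntegrable (fun t => ∫ x in (0 : ℝ)..1, G t x) volume a d := fun hG =>
    ((continuousOn_parametric_integral hG).mono (by rwa [uIcc_of_le had])).intervalIntegrable
  rw [← intervalIntegral.integral_sub (hint (by simp only [hUe, hDe]; fun_prop))
    (hint (by simp only [hUe, hDe]; fun_prop)),
    ← neg_eq_zero, ← intervalIntegral.integral_neg] at h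
  refine Eq.trans ?_ h
  refine intervalIntegral.integral_congr (fun t ht => ?_)
  rw [uIcc_of_le had] at ht
  have htT := hsub ht
  have hut := hu.continuous_slice t htT
  have hdt := hu.continuous_deriv hs htT
  have key := integral_pow_mul_deriv_add (hu.differentiable hs htT) hdt
    (hu.continuousInSobolev.mem t htT).periodic hψ hper (q + 1)
  have hint' : ∀ {g : ℝ → ℝ}, Continuous g → IntervalIntegrable g volume 0 1 :=
    fun hg => hg.intervalIntegrable _ _
  have hflux : Continuous (flux b c (q + 1) (u t)) := by unfold flux; fun_prop
  rw [eq_neg_iff_add_eq_zero, ← intervalIntegral.integral_sub (hint' (by fun_prop))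
    (hint' (by fun_prop)), ← intervalIntegral.integral_const_mul,
    ← intervalIntegral.integral_const_mul, ← intervalIntegral.integral_add (hint' (by fun_prop))
    (hint' (by fun_prop)), ← intervalIntegral.integral_add (hint' (by fun_prop))
    (hint' (by fun_prop))]
  -- The factor `b/(p+1)` trades `-b u^p u_x ψ` for the term `b/(p+1) u^(p+1) ψ'` of the flux.
  have key2 := congrArg (fun r => θ t * (b / (((q + 1 : ℕ) : ℝ) + 1)) * r) key
  simp only [mul_zero] at key2
  rw [← intervalIntegral.integral_const_mul] at key2
  refine Eq.trans ?_ key2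
  refine intervalIntegral.integral_congr (fun x _ => ?_)
  simp only [flux, Nat.add_sub_cancel]
  have hA : b = b / (((q + 1 : ℕ) : ℝ) + 1) * (((q + 1 : ℕ) : ℝ) + 1) := by
    field_simp
  generalize b / (((q + 1 : ℕ) : ℝ) + 1) = A at hA ⊢
  linear_combination
    (u t x ^ (q + 1) * deriv (u t) x * ψ x * θ t) * hA
      - (1 / 2) * (u t x ^ (q + 1 - 2) * deriv (u t) x ^ 3 * θ t * ψ x) * hbc

end WeakForm

/-! ### The spatial test function -/

/-- A smooth `1`-periodic `ψ` which, outside the translates of `(m - δ, m + δ)`, is increasing and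
satisfies `ψ'' = ψ`. -/
theorem exists_periodic_profile (m : ℝ) {δ : ℝ} (hδ : 0 < δ) :
    ∃ ψ : ℝ → ℝ, ContDiff ℝ ∞ ψ ∧ Function.Periodic ψ 1 ∧
      ∀ x, (∃ n : ℤ, |x - n - m| < δ) ∨ (iteratedDeriv 2 ψ x = ψ x ∧ 0 < deriv ψ x) := by
  -- The cutoff argument is smooth and `1`-periodic, negative on `m + ℤ`, where the periodized
  -- `sinh` below jumps, and above `1` at distance at least `δ` from it.
  set w : ℝ → ℝ := fun x => Real.sin (Real.pi * (x - m)) ^ 2 / δ ^ 2 - 1 with hw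
  have hwc : ContDiff ℝ ∞ w := by unfold w; fun_prop
  set ψ : ℝ → ℝ := fun x => Real.smoothTransition (w x) * Real.sinh (Int.fract (x - m) - 1 / 2)
    with hψ
  have hloc : ∀ x, Int.fract (x - m) ≠ 0 → ∀ᶠ y in 𝓝 x,
      Int.fract (y - m) = y - m - ⌊x - m⌋ := by
    intro x hx
    have h1 : (⌊x - m⌋ : ℝ) < x - m := by
      have := Int.self_sub_floor (x - m)
      have := lt_of_le_of_ne (Int.fract_nonneg (x - m)) (Ne.symm hx)
      linarith
    have h2 := Int.lt_floor_add_one (x - m)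
    filter_upwards [Ioo_mem_nhds (show (⌊x - m⌋ : ℝ) + m < x by linarith)
      (show x < (⌊x - m⌋ : ℝ) + 1 + m by linarith)] with y hy
    have : ⌊y - m⌋ = ⌊x - m⌋ := Int.floor_eq_iff.mpr ⟨by linarith [hy.1], by linarith [hy.2]⟩
    rw [← Int.self_sub_floor, this]
  have hsin : ∀ x, Real.sin (Real.pi * (x - m)) ^ 2 =
      Real.sin (Real.pi * Int.fract (x - m)) ^ 2 := by
    intro x
    have : Real.pi * (x - m) = Real.pi * Int.fract (x - m) + ⌊x - m⌋ * Real.pi := by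
      rw [← Int.self_sub_floor]; ring
    rw [this, Real.sin_add_int_mul_pi, mul_pow, ← zpow_natCast, zpow_comm]
    simp
  refine ⟨ψ, contDiff_iff_contDiffAt.mpr fun x => ?_, fun x => ?_, fun x => ?_⟩
  · by_cases hx : Int.fract (x - m) = 0
    · have hwx : w x < 0 := by simp only [hw, hsin, hx]; simp
      have : ψ =ᶠ[𝓝 x] fun _ => 0 := by
        filter_upwards [hwc.continuous.continuousAt.eventually_lt_const hwx] with y hy
        simp [hψ, Real.smoothTransition.zero_of_nonpos hy.le]
      exact contDiffAt_const.congr_of_eventuallyEq this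
    · have : ψ =ᶠ[𝓝 x] fun y => Real.smoothTransition (w y) *
          Real.sinh (y - m - ⌊x - m⌋ - 1 / 2) := by
        filter_upwards [hloc x hx] with y hy
        simp only [hψ, hy]
      refine ContDiffAt.congr_of_eventuallyEq (ContDiff.contDiffAt ?_) this
      exact (Real.smoothTransition.contDiff.comp hwc).mul
        (Real.contDiff_sinh.comp (by fun_prop))
  · have h1 : Int.fract (x + 1 - m) = Int.fract (x - m) := by
      rw [show x + 1 - m = x - m + 1 by ring, Int.fract_add_one]
    simp only [hψ, hw, hsin, h1]
  · rw [or_iff_not_imp_left]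
    intro hn
    push Not at hn
    have hy0 := Int.fract_nonneg (x - m)
    have hy1 := Int.fract_lt_one (x - m)
    have hself := Int.self_sub_floor (x - m)
    have hl : δ ≤ Int.fract (x - m) := by
      have := hn ⌊x - m⌋
      rwa [show x - ⌊x - m⌋ - m = Int.fract (x - m) by rw [← hself]; ring,
        abs_of_nonneg hy0] at this
    have hr : δ ≤ 1 - Int.fract (x - m) := by
      have := hn (⌊x - m⌋ + 1)
      rwa [show x - (⌊x - m⌋ + 1 : ℤ) - m = -(1 - Int.fract (x - m)) by
        rw [← hself]; push_cast; ring, abs_neg, abs_of_nonneg (by linarith)] at this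
    have hsn : 2 * δ ≤ Real.sin (Real.pi * Int.fract (x - m)) := by
      -- Jordan's inequality `sin (πy) ≥ 2y`; it yields `w ≥ 4 - 1 > 1`.
      have aux : ∀ y, δ ≤ y → y ≤ 1 / 2 → 2 * δ ≤ Real.sin (Real.pi * y) := by
        intro y h1 h2
        have := Real.mul_le_sin (x := Real.pi * y) (by positivity [hδ.trans_le h1])
          (by nlinarith [Real.pi_pos])
        have e : 2 / Real.pi * (Real.pi * y) = 2 * y := by field_simp
        linarith
      rcases le_total (Int.fract (x - m)) (1 / 2) with h | h
      · exact aux _ hl h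
      · have := aux _ hr (by linarith)
        rwa [mul_sub, mul_one, Real.sin_pi_sub] at this
    have hwx : 1 < w x := by
      simp only [hw, hsin]
      have : 4 ≤ Real.sin (Real.pi * Int.fract (x - m)) ^ 2 / δ ^ 2 := by
        rw [le_div_iff₀ (by positivity)]
        nlinarith
      linarith
    have hev : ψ =ᶠ[𝓝 x] fun y => Real.sinh (y - m - ⌊x - m⌋ - 1 / 2) := by
      filter_upwards [hloc x (by linarith [hδ.trans_le hl] : Int.fract (x - m) ≠ 0),
        hwc.continuous.continuousAt.eventually_const_lt hwx] with y hy hy2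
      simp only [hψ, hy, Real.smoothTransition.one_of_one_le hy2.le, one_mul]
    have hd1 : (deriv fun y => Real.sinh (y - m - ⌊x - m⌋ - 1 / 2)) =
        fun y => Real.cosh (y - m - ⌊x - m⌋ - 1 / 2) := by
      ext y
      simp
    have hd2 : (deriv fun y => Real.cosh (y - m - ⌊x - m⌋ - 1 / 2)) =
        fun y => Real.sinh (y - m - ⌊x - m⌋ - 1 / 2) := by
      ext y
      simp
    refine ⟨?_, ?_⟩
    · rw [iteratedDeriv_succ, iteratedDeriv_one, hev.deriv.deriv_eq, hd1, hd2, hev.eq_of_nhds]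
    · rw [hev.deriv_eq, hd1]
      exact Real.cosh_pos _

theorem apply_eq_zero_of_periodic {g : ℝ → ℝ} (hg : Function.Periodic g 1)
    (h : ∀ x ∈ Icc (0 : ℝ) 1, g x = 0) (x : ℝ) : g x = 0 := by
  rw [← h (Int.fract x) ⟨Int.fract_nonneg x, (Int.fract_lt_one x).le⟩]
  have := hg.sub_int_mul_eq ⌊x⌋ (x := x)
  rw [mul_one, Int.self_sub_floor] at this
  exact this.symm

theorem periodic_deriv {f : ℝ → ℝ} (hf : Function.Periodic f 1) :
    Function.Periodic (deriv f) 1 := fun x => by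
  rw [← deriv_comp_add_const, show (fun y => f (y + 1)) = f from funext hf]

theorem deriv_eq_zero_of_mul_nonneg {f : ℝ → ℝ} {ε : ℝ} (hε : ε ≠ 0) (h : ∀ x, 0 ≤ ε * f x)
    {x : ℝ} (hx : f x = 0) : deriv f x = 0 := by
  have h1 : IsLocalMin (fun y => ε * f y) x :=
    Eventually.of_forall fun y => by simpa [hx] using h y
  have h2 := h1.deriv_eq_zero
  rw [deriv_const_mul_field] at h2
  exact (mul_eq_zero.mp h2).resolve_left hε

/-! ### Sign and zeros of the flux -/

section Flux

variable {b c ε : ℝ} {p : ℕ} {f : ℝ → ℝ}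

theorem flux_coeff_nonneg (hb : 0 ≤ b) (hc : 0 < c)
    (hparam : (p = 1 ∧ b ∈ Icc 0 (3 * c)) ∨ b = (p : ℝ) * c) : 0 ≤ (3 * p * c - b) / 2 := by
  rcases hparam with ⟨rfl, h⟩ | h
  · push_cast; linarith [h.2]
  · have : 0 ≤ (p : ℝ) * c := by positivity
    linarith

/-- Only the factor `f^(p-1)` can be negative, and `ε^(p-1)` corrects it; this treats both signs of
`u` at once. -/
theorem mul_flux_nonneg (hb : 0 ≤ b) (hc : 0 < c)
    (hparam : (p = 1 ∧ b ∈ Icc 0 (3 * c)) ∨ b = (p : ℝ) * c) (h : ∀ x, 0 ≤ ε * f x) (x : ℝ) :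
    0 ≤ ε ^ (p - 1) * flux b c p f x := by
  have hB := flux_coeff_nonneg hb hc hparam
  unfold flux
  rw [← mul_assoc, ← mul_pow]
  have := pow_nonneg (h x) (p - 1)
  positivity

/-- For `p = 1` the factor `f^(p-1)` is `1`, so `f' = 0` is needed as well: a zero of `f` is a
minimum of `εf`. -/
theorem flux_eq_zero_of_apply_eq_zero (hε : ε ≠ 0) (h : ∀ x, 0 ≤ ε * f x) {x : ℝ}
    (hx : f x = 0) : flux b c p f x = 0 := by
  simp [flux, hx, deriv_eq_zero_of_mul_nonneg hε h hx]

theorem periodic_flux (hf : Function.Periodic f 1) : Function.Periodic (flux b c p f) 1 :=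
  fun x => by simp only [flux, hf x, periodic_deriv hf x]

theorem apply_eq_zero_of_flux_eq_zero (hb : 0 ≤ b) (hc : 0 < c) (hp : 0 < p)
    (hparam : (p = 1 ∧ b ∈ Icc 0 (3 * c)) ∨ b = (p : ℝ) * c) (hf : Differentiable ℝ f)
    (h : ∀ x, flux b c p f x = 0) {x₀ : ℝ} (hx₀ : f x₀ = 0) (x : ℝ) : f x = 0 := by
  have hB := flux_coeff_nonneg hb hc hparam
  -- For `b = 0` the flux controls only `f'`, so `f` is constant and the zero `x₀` is needed; for `b
  -- > 0` the term in `f²` suffices.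
  rcases hb.eq_or_lt with rfl | hb
  · have hp1 : p = 1 := by
      rcases hparam with h | h
      · exact h.1
      · have : 0 < (p : ℝ) * c := by positivity
        exact absurd h this.ne
    subst hp1
    have hd : ∀ y, deriv f y = 0 := fun y => by
      have := h y
      simpa [flux, hc.ne'] using this
    rw [is_const_of_deriv_eq_zero hf hd x x₀, hx₀]
  · by_contra hne
    have h1 : 0 < b / (p + 1) * f x ^ 2 := by positivity
    have h2 : 0 ≤ (3 * p * c - b) / 2 * deriv f x ^ 2 := by positivity
    exact mul_ne_zero (pow_ne_zero _ hne) (by linarith : b / (p + 1) * f x ^ 2 +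
      (3 * p * c - b) / 2 * deriv f x ^ 2 ≠ 0) (h x)

end Flux

/-- A smooth function with derivative the difference of two bump functions of integral one. -/
theorem exists_primitive_sub_bump {τ σ : ℝ} (f : ContDiffBump τ) (g : ContDiffBump σ) {a d : ℝ}
    (h1 : Metric.ball τ f.rOut ⊆ Ioc a d) (h2 : Metric.ball σ g.rOut ⊆ Ioc a d) :
    ∃ θ : ℝ → ℝ, ContDiff ℝ ∞ θ ∧ (∀ t, t ∉ Icc a d → θ t = 0) ∧
      ∀ t, deriv θ t = f.normed volume t - g.normed volume t := by
  have hc : Continuous fun t => f.normed volume t - g.normed volume t :=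
    f.continuous_normed.sub g.continuous_normed
  have hd := fun t => hc.deriv_integral _ a t
  refine ⟨fun t => ∫ r in a..t, (f.normed volume r - g.normed volume r), ?_, ?_, hd⟩
  · rw [contDiff_infty_iff_deriv, funext hd]
    exact ⟨fun t => (hc.integral_hasStrictDerivAt a t).hasDerivAt.differentiableAt,
      f.contDiff_normed.sub g.contDiff_normed⟩
  · intro t ht
    have hzero : ∀ {ρ : ℝ} (k : ContDiffBump ρ), Metric.ball ρ k.rOut ⊆ Ioc a d →
        ∀ r, r ∉ Ioc a d → k.normed volume r = 0 := fun k hk r hr => by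
      by_contra hne
      have : r ∈ Function.support (k.normed volume) := hne
      rw [k.support_normed_eq] at this
      exact hr (hk this)
    rw [mem_Icc, not_and_or, not_le, not_le] at ht
    change ∫ r in a..t, (f.normed volume r - g.normed volume r) = 0
    rcases ht with ht | ht
    · rw [intervalIntegral.integral_congr (g := fun _ => (0 : ℝ)), intervalIntegral.integral_zero]
      intro r hr
      rw [uIcc_of_ge ht.le] at hr
      have : r ∉ Ioc a d := fun h => absurd h.1 (not_lt.mpr hr.2)
      simp [hzero f h1 r this, hzero g h2 r this]
    -- Beyond `d` both bumps have been integrated completely, and `1 - 1 = 0`.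
    · rw [intervalIntegral.integral_sub (f.continuous_normed.intervalIntegrable _ _)
        (g.continuous_normed.intervalIntegrable _ _),
        intervalIntegral.integral_eq_integral_of_support_subset,
        intervalIntegral.integral_eq_integral_of_support_subset, f.integral_normed,
        g.integral_normed, sub_self]
      · rw [g.support_normed_eq]; exact h2.trans (Ioc_subset_Ioc_right ht.le)
      · rw [f.support_normed_eq]; exact h1.trans (Ioc_subset_Ioc_right ht.le)

/-! ### From the rectangle to its time slices, then to all times -/

section Continuation

variable {b c s ε : ℝ} {p : ℕ} {T : EReal} {u : ℝ → ℝ → ℝ}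

theorem sub_one_mul_sub_eq_zero (hparam : (p = 1 ∧ b ∈ Icc 0 (3 * c)) ∨ b = (p : ℝ) * c) :
    ((p : ℝ) - 1) * (p * c - b) = 0 := by
  rcases hparam with ⟨rfl, -⟩ | h
  · simp
  · simp [h]

/-- At each point either `u` vanishes or `ψ'' = ψ` and `ψ' > 0`. Hence every term of the weak form
without the flux drops out, and the remaining integrand is nonnegative after multiplication by
`ε^(p-1)`. -/
theorem IsSobolevSolution.slice_eq_zero_of_rectangle (hu : IsSobolevSolution b c p s T u)
    (hs : 3 / 2 < s) (hb : 0 ≤ b) (hc : 0 < c) (hp : 0 < p)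
    (hparam : (p = 1 ∧ b ∈ Icc 0 (3 * c)) ∨ b = (p : ℝ) * c)
    (hε : ε ≠ 0) (hsign : ∀ t ∈ timeInterval T, ∀ x, 0 ≤ ε * u t x) {t₀ t₁ x₀ x₁ : ℝ}
    (hx : x₀ < x₁) (hsub : Ioo t₀ t₁ ⊆ timeInterval T)
    (hzero : ∀ t ∈ Ioo t₀ t₁, ∀ x ∈ Ioo x₀ x₁, u t x = 0) :
    ∀ t ∈ Ioo t₀ t₁, ∀ x, u t x = 0 := by
  intro τ hτ
  obtain ⟨ψ, hψ, hper, hψ1⟩ := exists_periodic_profile ((x₀ + x₁) / 2)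
    (δ := (x₁ - x₀) / 2) (by linarith)
  have hut : ∀ t ∈ Ioo t₀ t₁, ∀ x, u t x = 0 ∨ (iteratedDeriv 2 ψ x = ψ x ∧ 0 < deriv ψ x) := by
    intro t ht x
    refine (hψ1 x).imp_left ?_
    rintro ⟨n, hn⟩
    have h1 := hzero t ht (x - n) (by
      rw [abs_lt] at hn
      constructor <;> linarith [hn.1, hn.2])
    have h2 := (hu.continuousInSobolev.mem t (hsub ht)).periodic.sub_int_mul_eq n (x := x)
    rw [mul_one] at h2
    rw [← h2, h1]
  have hψ' : Continuous (deriv ψ) := hψ.continuous_deriv (by simp)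
  obtain ⟨r, hr0, hr1, hr2⟩ : ∃ r, 0 < r ∧ t₀ < τ - r ∧ τ + r < t₁ := by
    refine ⟨min (τ - t₀) (t₁ - τ) / 2, ?_, ?_, ?_⟩ <;>
    rcases hτ with ⟨h1, h2⟩ <;>
    have := min_le_left (τ - t₀) (t₁ - τ) <;>
    have := min_le_right (τ - t₀) (t₁ - τ) <;>
    have : 0 < min (τ - t₀) (t₁ - τ) := lt_min (by linarith) (by linarith) <;>
    linarith
  have hIcc : Icc (τ - r) (τ + r) ⊆ Ioo t₀ t₁ := fun t ht =>
    ⟨hr1.trans_le ht.1, ht.2.trans_lt hr2⟩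
  have ha : 0 < τ - r := by
    -- An admissible, hence nonnegative, time strictly below `τ - r`.
    have : (t₀ + (τ - r)) / 2 ∈ timeInterval T := hsub ⟨by linarith, by linarith⟩
    linarith [this.1]
  let β : ContDiffBump τ := ⟨r / 2, r, by linarith, by linarith⟩
  have hβ0 : ∀ t, t ∉ Icc (τ - r) (τ + r) → β t = 0 := fun t ht => by
    refine β.zero_of_le_dist ?_
    rw [← Real.closedBall_eq_Icc, Metric.mem_closedBall, not_le] at ht
    exact ht.le
  have hd : τ + r ∈ timeInterval T := hsub (hIcc ⟨by linarith, le_rfl⟩)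
  have hw := hu.weak_form_mul hs hp (sub_one_mul_sub_eq_zero hparam) β.contDiff hψ hper ha
    (by linarith) hd hβ0
  set H : ℝ → ℝ := fun t => ∫ x in (0 : ℝ)..1, ε ^ (p - 1) * (flux b c p (u t) x * deriv ψ x)
    with hH
  have hnn : ∀ t ∈ Ioo t₀ t₁, ∀ x, 0 ≤ ε ^ (p - 1) * (flux b c p (u t) x * deriv ψ x) := by
    intro t ht x
    rcases hut t ht x with h | ⟨-, h⟩
    · rw [flux_eq_zero_of_apply_eq_zero hε (hsign t (hsub ht)) h]; simp
    · rw [← mul_assoc]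
      exact mul_nonneg (mul_flux_nonneg hb hc hparam (hsign t (hsub ht)) x) h.le
  have hHc : ContinuousOn H (timeInterval T) := by
    obtain ⟨U, hU, hUe⟩ : ∃ U : timeInterval T × ℝ → ℝ, Continuous U ∧ ∀ z, u z.1 z.2 = U z :=
      ⟨_, hu.continuous_uncurry hs, fun _ => rfl⟩
    obtain ⟨D, hD, hDe⟩ : ∃ D : timeInterval T × ℝ → ℝ, Continuous D ∧
        ∀ z, deriv (u z.1) z.2 = D z := ⟨_, hu.continuous_uncurry_deriv hs, fun _ => rfl⟩
    exact continuousOn_parametric_integral (by simp only [flux, hUe, hDe]; fun_prop)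
  have hw2 : ∫ t in (τ - r)..(τ + r), β t * H t = 0 := by
    have e := congrArg (fun y => ε ^ (p - 1) * y) hw
    simp only [mul_zero] at e
    rw [← intervalIntegral.integral_const_mul] at e
    refine Eq.trans (intervalIntegral.integral_congr fun t ht => ?_) e
    rw [uIcc_of_le (by linarith)] at ht
    have ht' := hIcc ht
    have e1 : ∫ x in (0 : ℝ)..1, u t x * (ψ x - iteratedDeriv 2 ψ x) = 0 := by
      rw [intervalIntegral.integral_congr (g := fun _ => 0), intervalIntegral.integral_zero]
      intro x _
      rcases hut t ht' x with h | ⟨h, -⟩ <;> simp [h]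
    have e2 : ∫ x in (0 : ℝ)..1, (flux b c p (u t) x * deriv ψ x +
        c * u t x ^ p * deriv (u t) x * (iteratedDeriv 2 ψ x - ψ x)) =
        ∫ x in (0 : ℝ)..1, flux b c p (u t) x * deriv ψ x := by
      refine intervalIntegral.integral_congr fun x _ => ?_
      rcases hut t ht' x with h | ⟨h, -⟩ <;> simp [h, hp.ne']
    simp only [e1, e2, hH, intervalIntegral.integral_const_mul]
    ring
  have hHτ : H τ = 0 := by
    have := eq_zero_of_integral_eq_zero (by linarith)
      (β.continuous.continuousOn.mul (hHc.mono (hIcc.trans hsub)))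
      (fun t ht => mul_nonneg β.nonneg (intervalIntegral.integral_nonneg zero_le_one
        fun x _ => hnn t (hIcc ht) x)) hw2 τ ⟨by linarith, by linarith⟩
    rwa [Pi.mul_apply, β.one_of_mem_closedBall (Metric.mem_closedBall_self β.rIn_pos.le), one_mul] at this
  have hcu := hu.continuous_slice τ (hsub hτ)
  have hcd := hu.continuous_deriv hs (hsub hτ)
  have hflux := eq_zero_of_integral_eq_zero zero_lt_one
    (Continuous.continuousOn (by unfold flux; fun_prop)) (fun x _ => hnn τ hτ x) hHτ
  have hflux0 : ∀ x, flux b c p (u τ) x = 0 := by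
    refine apply_eq_zero_of_periodic
      (periodic_flux (hu.continuousInSobolev.mem τ (hsub hτ)).periodic) fun x hx => ?_
    rcases hut τ hτ x with h | ⟨-, h⟩
    · exact flux_eq_zero_of_apply_eq_zero hε (hsign τ (hsub hτ)) h
    · simpa [hε, h.ne'] using hflux x hx
  exact apply_eq_zero_of_flux_eq_zero hb hc hp hparam (hu.differentiable hs (hsub hτ)) hflux0
    (hzero τ hτ ((x₀ + x₁) / 2) ⟨by linarith, by linarith⟩)

/-- Conservation of `∫ u dx`, tested with `ψ = 1` and `θ'` a bump at `τ` minus a bump at a time `σ`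
whose nearby slices vanish. -/
theorem IsSobolevSolution.eq_zero_of_slices (hu : IsSobolevSolution b c p s T u)
    (hs : 3 / 2 < s) (hp : 0 < p) (hbc : ((p : ℝ) - 1) * (p * c - b) = 0)
    (hε : ε ≠ 0) (hsign : ∀ t ∈ timeInterval T, ∀ x, 0 ≤ ε * u t x) {t₀ t₁ : ℝ}
    (ht : t₀ < t₁) (hsub : Ioo t₀ t₁ ⊆ timeInterval T)
    (hzero : ∀ t ∈ Ioo t₀ t₁, ∀ x, u t x = 0) {τ : ℝ} (hτ : τ ∈ timeInterval T) (hτ0 : 0 < τ)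
    (x : ℝ) : u τ x = 0 := by
  obtain ⟨d', hτd, hd'⟩ := EReal.lt_iff_exists_real_btwn.mp hτ.2
  have hτd : τ < d' := by exact_mod_cast hτd
  have hd'T : d' ∈ timeInterval T := ⟨(hτ0.trans hτd).le, hd'⟩
  have ht₀ : 0 ≤ t₀ := by
    by_contra hneg
    push Not at hneg
    obtain ⟨y, hy1, hy2⟩ := exists_between (lt_min hneg ht)
    have := (hsub ⟨hy1, hy2.trans_le (min_le_right _ _)⟩).1
    linarith [hy2.trans_le (min_le_left (0 : ℝ) t₁)]
  set σ := (t₀ + t₁) / 2 with hσ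
  -- Small enough that both bumps live in `(0, T)` and the one at `σ` lives in `(t₀, t₁)`.
  set r := min (min τ (d' - τ)) ((t₁ - t₀) / 2) / 2 with hr
  have hr0 : 0 < r := by
    have : 0 < min (min τ (d' - τ)) ((t₁ - t₀) / 2) :=
      lt_min (lt_min hτ0 (by linarith)) (by linarith)
    linarith
  have hr3 : 2 * r ≤ (t₁ - t₀) / 2 := by
    have := min_le_right (min τ (d' - τ)) ((t₁ - t₀) / 2); linarith
  have hr4 : 2 * r ≤ min τ (d' - τ) := by
    have := min_le_left (min τ (d' - τ)) ((t₁ - t₀) / 2); linarith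
  have hr1 : 2 * r ≤ τ := hr4.trans (min_le_left _ _)
  have hr2 : 2 * r ≤ d' - τ := hr4.trans (min_le_right _ _)
  let f : ContDiffBump τ := ⟨r / 2, r, by linarith, by linarith⟩
  let g : ContDiffBump σ := ⟨r / 2, r, by linarith, by linarith⟩
  set a := min (τ - r) (σ - r) with ha
  set d := max (τ + r) (σ + r) with hd
  have haτ : a ≤ τ - r := min_le_left _ _
  have haσ : a ≤ σ - r := min_le_right _ _
  have hdτ : τ + r ≤ d := le_max_left _ _
  have hdσ : σ + r ≤ d := le_max_right _ _
  have ha0 : 0 < a := lt_min (by linarith) (by linarith)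
  have hdT : d ∈ timeInterval T := by
    rcases max_choice (τ + r) (σ + r) with h | h
    · rw [hd, h]; exact mem_timeInterval_of_le hd'T (by linarith) (by linarith)
    · rw [hd, h]; exact hsub ⟨by linarith, by linarith⟩
  obtain ⟨θ, hθ, hθ0, hθ'⟩ := exists_primitive_sub_bump f g (a := a) (d := d)
    (by rw [Real.ball_eq_Ioo]
        exact fun t ht => ⟨haτ.trans_lt ht.1, ht.2.le.trans hdτ⟩)
    (by rw [Real.ball_eq_Ioo]
        exact fun t ht => ⟨haσ.trans_lt ht.1, ht.2.le.trans hdσ⟩)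
  have hw := hu.weak_form_mul hs hp hbc hθ (contDiff_const (c := (1 : ℝ))) (fun _ => rfl) ha0
    (by linarith) hdT hθ0
  have hIcc : Icc a d ⊆ timeInterval T := fun t ht =>
    mem_timeInterval_of_le hdT (ha0.le.trans ht.1) ht.2
  set I : ℝ → ℝ := fun t => ∫ x in (0 : ℝ)..1, ε * u t x with hI
  have hIc : ContinuousOn I (timeInterval T) :=
    continuousOn_parametric_integral (continuous_const.mul (hu.continuous_uncurry hs))
  have hw2 : ∫ t in a..d, f.normed volume t * I t = 0 := by
    have e := congrArg (fun y => ε * y) hw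
    simp only [mul_zero] at e
    rw [← intervalIntegral.integral_const_mul] at e
    refine Eq.trans (intervalIntegral.integral_congr fun t ht => ?_) e
    rw [uIcc_of_le (by linarith)] at ht
    have htT := hIcc ht
    have hper := (hu.continuousInSobolev.mem t htT).periodic
    have e1 : ∫ x in (0 : ℝ)..1, (flux b c p (u t) x * deriv (fun _ => (1 : ℝ)) x +
        c * u t x ^ p * deriv (u t) x * (iteratedDeriv 2 (fun _ => (1 : ℝ)) x - 1)) = 0 := by
      -- For `ψ = 1` only `-c u^p u_x` is left, an exact derivative of a periodic function.
      have h1 := integral_pow_mul_deriv_add (hu.differentiable hs htT) (hu.continuous_deriv hs htT)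
        hper (contDiff_const (c := (1 : ℝ))) (fun _ => rfl) p
      have h2 := congrArg (fun y => -(c / (p + 1)) * y) h1
      simp only [mul_zero] at h2
      rw [← intervalIntegral.integral_const_mul] at h2
      refine Eq.trans (intervalIntegral.integral_congr fun x _ => ?_) h2
      simp [iteratedDeriv_const]
      field_simp
    have e2 : ∫ x in (0 : ℝ)..1, u t x * (1 - iteratedDeriv 2 (fun _ => (1 : ℝ)) x) =
        ∫ x in (0 : ℝ)..1, u t x := by
      simp [iteratedDeriv_const]
    have e3 : g.normed volume t * ∫ x in (0 : ℝ)..1, u t x = 0 := by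
      by_cases hg : g.normed volume t = 0
      · simp [hg]
      · have : t ∈ Function.support (g.normed volume) := hg
        rw [g.support_normed_eq, Real.ball_eq_Ioo] at this
        have hz := hzero t ⟨by linarith [this.1, show g.rOut = r from rfl],
          by linarith [this.2, show g.rOut = r from rfl]⟩
        simp [hz]
    simp only [e1, e2, hI, hθ', intervalIntegral.integral_const_mul]
    linear_combination ε * e3
  have hIτ : I τ = 0 := by
    have := eq_zero_of_integral_eq_zero (by linarith)
      (f.continuous_normed.continuousOn.mul (hIc.mono hIcc))
      (fun t ht => mul_nonneg (f.nonneg_normed t) (intervalIntegral.integral_nonneg zero_le_one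
        fun x _ => hsign t (hIcc ht) x)) hw2 τ ⟨by linarith, by linarith⟩
    refine (mul_eq_zero.mp this).resolve_left ?_
    have : τ ∈ Function.support (f.normed volume) := by
      rw [f.support_normed_eq]; exact Metric.mem_ball_self f.rOut_pos
    exact this
  refine apply_eq_zero_of_periodic (hu.continuousInSobolev.mem τ hτ).periodic (fun y hy => ?_) x
  have := eq_zero_of_integral_eq_zero zero_lt_one
    (continuous_const.mul (hu.continuous_slice τ hτ)).continuousOn
    (fun x _ => hsign τ hτ x) hIτ y hy
  exact (mul_eq_zero.mp this).resolve_left hε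

/-- Test functions vanish near `t = 0`, so the initial time is reached only through the continuity
of `u` in `t`. -/
theorem IsSobolevSolution.eq_zero_of_forall_pos (hu : IsSobolevSolution b c p s T u)
    (hs : 3 / 2 < s) {d : ℝ} (hd : d ∈ timeInterval T) (hd0 : 0 < d)
    (h : ∀ t ∈ timeInterval T, 0 < t → ∀ x, u t x = 0) :
    ∀ t ∈ timeInterval T, ∀ x, u t x = 0 := by
  intro t ht x
  rcases ht.1.eq_or_lt with rfl | h0
  · have hc : ContinuousOn (fun t => u t x) (timeInterval T) := by
      rw [continuousOn_iff_continuous_domRestrict]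
      exact (hu.continuous_uncurry hs).comp (continuous_id.prodMk continuous_const)
    have hmem : Ioo 0 d ∈ 𝓝[>] (0 : ℝ) := Ioo_mem_nhdsGT hd0
    have hle : 𝓝[>] (0 : ℝ) ≤ 𝓝[timeInterval T] 0 :=
      nhdsWithin_le_iff.mpr (mem_of_superset hmem
        fun y hy => mem_timeInterval_of_le hd hy.1.le hy.2.le)
    have h1 : Tendsto (fun t => u t x) (𝓝[>] 0) (𝓝 (u 0 x)) := (hc 0 ht).mono_left hle
    refine tendsto_nhds_unique (h1.congr' ?_) tendsto_const_nhds
    filter_upwards [hmem] with y hy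
    exact h y (mem_timeInterval_of_le hd hy.1.le hy.2.le) hy.1 x
  · exact h t ht h0 x

end Continuation

end PeriodicShallowWater

theorem theorem2p4 (b c : ℝ) (p : ℕ) (hb : 0 ≤ b) (hc : 0 < c) (hp : 0 < p)
    (hparam : (p = 1 ∧ b ∈ Set.Icc 0 (3 * c)) ∨ b = (p : ℝ) * c)
    (s : ℝ) (hs : 3 / 2 < s) (T : EReal) (u : ℝ → ℝ → ℝ)
    (hu : PeriodicShallowWater.IsSobolevSolution b c p s T u)
    (hsign : (∀ t ∈ PeriodicShallowWater.timeInterval T, ∀ x, 0 ≤ u t x) ∨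
      (∀ t ∈ PeriodicShallowWater.timeInterval T, ∀ x, u t x ≤ 0))
    (t₀ t₁ x₀ x₁ : ℝ) (ht : t₀ < t₁) (hx : x₀ < x₁)
    (hsub : Set.Ioo t₀ t₁ ⊆ PeriodicShallowWater.timeInterval T)
    (hzero : ∀ t ∈ Set.Ioo t₀ t₁, ∀ x ∈ Set.Ioo x₀ x₁, u t x = 0) :
    ∀ t ∈ PeriodicShallowWater.timeInterval T, ∀ x, u t x = 0 := by
  obtain ⟨ε, hε, hsign'⟩ : ∃ ε : ℝ, ε ≠ 0 ∧ ∀ t ∈ PeriodicShallowWater.timeInterval T,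
      ∀ x, 0 ≤ ε * u t x := by
    rcases hsign with h | h
    · exact ⟨1, one_ne_zero, fun t ht x => by linarith [h t ht x]⟩
    · exact ⟨-1, by norm_num, fun t ht x => by linarith [h t ht x]⟩
  have hz := hu.slice_eq_zero_of_rectangle hs hb hc hp hparam hε hsign' hx hsub hzero
  obtain ⟨y, hy1, hy2⟩ := exists_between ht
  obtain ⟨d, hd1, hd2⟩ := exists_between hy2
  have hy := hsub ⟨hy1, hy2⟩
  exact hu.eq_zero_of_forall_pos hs (hsub ⟨hy1.trans hd1, hd2⟩) (hy.1.trans_lt hd1)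
    fun τ hτ hτ0 x => hu.eq_zero_of_slices hs hp
      (PeriodicShallowWater.sub_one_mul_sub_eq_zero hparam) hε hsign' ht hsub hz hτ hτ0 x
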